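/- Let $d\ge 1$ and let $\mathcal Q$ be the compact convex set of quantum channels on $\mathbb C^d$, i.e. of the linear maps $\rho\mapsto\sum_l A_l\rho A_l^\dagger$ on $d\times d$ complex matrices with $\sum_l A_l^\dagger A_l=I$. Let $\mathrm{ri}(\mathcal Q)$ be its relative interior (the interior in its affine hull) and $\partial\mathcal Q=\mathcal Q\setminus\mathrm{ri}(\mathcal Q)$. For $\mathcal F\in\mathcal Q$, the boundariness of $\mathcal F$ is $$b(\mathcal F)=1-\sup\,\max_j \pi_j ,$$ where the supremum is over all finite convex decompositions $\mathcal F=\sum_j\pi_j\mathcal X_j$ ($0\le\pi_j\le1$, $\sum_j\pi_j=1$) with all $\mathcal X_j\in\partial\mathcal Q$ (the supremum of the empty set, which occurs only for $d=1$, is $0$). The Choi–Jamiołkowski operator of $\mathcal E$ is $$J_{\mathcal E}=(\mathcal E\otimes\mathcal I)[\Psi_+],\qquad \Psi_+=\frac1d\sum_{j,k=1}^d|jj\rangle\langle kk| .$$ For a unitary $d\times d$ matrix $U$ let $\mathcal U$ be the unitary channel $\rho\mapsto U\rho U^\dagger$ and $|U\rangle\!\rangle=(U\otimes I)\sum_{j}|jj\rangle$.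 Write $\lambda_1(X)$ for the largest eigenvalue of a matrix $X$ all of whose eigenvalues are real. Theorem. Let $\mathcal F\in\mathrm{ri}(\mathcal Q)$. Then $J_{\mathcal F}$ is invertible; for every unitary $U$ all the eigenvalues of $J_{\mathcal F}^{-1}J_{\mathcal U}$ are real and $\langle\!\langle U|J_{\mathcal F}^{-1}|U\rangle\!\rangle$ is real; the maxima below, over all unitary $d\times d$ matrices $U$, exist and are positive; and $$b(\mathcal F)=\Big[\max_{U}\lambda_1\big(J_{\mathcal F}^{-1}J_{\mathcal U}\big)\Big]^{-1}=\frac{d}{\max_U\langle\!\langle U|J_{\mathcal F}^{-1}|U\rangle\!\rangle}.$$ Moreover, if $\mathcal F=b(\mathcal F)\,\mathcal E+(1-b(\mathcal F))\,\mathcal G$ for some $\mathcal E\in\mathcal Q$ and $\mathcal G\in\partial\mathcal Q$, then $\mathcal E$ is a unitary channel. -/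

import Mathlib

open scoped Kronecker Matrix

noncomputable section

/-! ## Compact convex sets: boundary points and boundariness -/

/-- The boundary `∂B = B \ ri(B)` of a convex set `B`: the points of `B` that are not interior
relative to the affine hull of `B`. -/
def relBoundary {V : Type*} [AddCommGroup V] [Module ℝ V] [TopologicalSpace V]
    (B : Set V) : Set V :=
  B \ intrinsicInterior ℝ B

/-- The maximal weights `max_j π_j` of all the finite convex decompositions `y = ∑ π_j x_j`
of `y` into boundary points `x_j ∈ ∂B`. -/
def boundaryWeights {V : Type*} [AddCommGroup V] [Module ℝ V] [TopologicalSpace V]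
    (B : Set V) (y : V) : Set ℝ :=
  {w | ∃ (m : ℕ) (p : Fin m → ℝ) (x : Fin m → V),
      (∀ j, 0 ≤ p j ∧ p j ≤ 1) ∧ ∑ j, p j = 1 ∧ (∀ j, x j ∈ relBoundary B) ∧
      y = ∑ j, p j • x j ∧ IsGreatest (Set.range p) w}

/-- The boundariness `b(y) = 1 - sup max_j π_j`, the supremum being over all the finite convex
decompositions of `y` into boundary points of `B`. All the weights lie in `[0, 1]`. -/
def boundariness {V : Type*} [AddCommGroup V] [Module ℝ V] [TopologicalSpace V]
    (B : Set V) (y : V) : ℝ :=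
  1 - sSup (boundaryWeights B y)

/-! ## Quantum channels -/

/-- Operators on `ℂ^d`, as matrices in the standard orthonormal basis. -/
abbrev Op (d : ℕ) : Type := Matrix (Fin d) (Fin d) ℂ

/-- Linear maps on operators on `ℂ^d`. In finite dimension every linear map is continuous; the
bundled continuous maps are used because they carry the usual topology. -/
abbrev SuperOp (d : ℕ) : Type := Op d →L[ℂ] Op d

/-- The set of quantum channels on `ℂ^d`: the maps `ρ ↦ ∑ A_l ρ A_l†` with `∑ A_l† A_l = I`. -/
def channels (d : ℕ) : Set (SuperOp d) :=
  {Φ | ∃ (m : ℕ) (A : Fin m → Op d), ∑ l, (A l)ᴴ * A l = 1 ∧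
      ∀ X : Op d, Φ X = ∑ l, A l * X * (A l)ᴴ}

/-- The map `X ↦ U X U†`; for a unitary `U` it is a unitary channel. -/
def conjMap {d : ℕ} (U : Op d) : SuperOp d where
  toFun X := U * X * Uᴴ
  map_add' X Y := by rw [Matrix.mul_add, Matrix.add_mul]
  map_smul' c X := by simp
  cont := by fun_prop

/-- The Choi–Jamiołkowski operator `J_Φ = (Φ ⊗ id)[Ψ₊]`, with
`Ψ₊ = (1/d) ∑_{j,k} |jj⟩⟨kk| = (1/d) ∑_{j,k} |j⟩⟨k| ⊗ |j⟩⟨k|`. -/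
def choi {d : ℕ} (Φ : SuperOp d) : Matrix (Fin d × Fin d) (Fin d × Fin d) ℂ :=
  (1 / (d : ℂ)) • ∑ j, ∑ k, Φ (Matrix.single j k 1) ⊗ₖ (Matrix.single j k 1 : Op d)

/-- The vector `|U⟩⟩ = (U ⊗ I) ∑_j |jj⟩` of `ℂ^d ⊗ ℂ^d`. -/
def vecOf {d : ℕ} (U : Op d) : Fin d × Fin d → ℂ :=
  (U ⊗ₖ (1 : Op d)) *ᵥ ∑ j, Pi.single (j, j) 1

/-- `⟨v| A |v⟩`. -/
def sandwich {ι : Type*} [Fintype ι] (A : Matrix ι ι ℂ) (v : ι → ℂ) : ℂ :=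
  star v ⬝ᵥ (A *ᵥ v)

/-- `l` is the maximal eigenvalue `λ₁(X)`: it is an eigenvalue of `X`, and all the (complex)
eigenvalues of `X` are real and at most `l`. -/
def IsMaxEigenvalue {ι : Type*} [Fintype ι] [DecidableEq ι] (X : Matrix ι ι ℂ) (l : ℝ) : Prop :=
  Module.End.HasEigenvalue (Matrix.toLin' X) (l : ℂ) ∧
    ∀ z : ℂ, Module.End.HasEigenvalue (Matrix.toLin' X) z → z.im = 0 ∧ z.re ≤ l

end

open scoped ComplexOrder MatrixOrder Topology

/-! ### The Choi operator -/

/-! Through the Choi operator, channels become the positive semidefinite matrices with partial trace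
`I/d`. The relative interior consists of those with positive definite Choi operator, the boundary of
those whose Choi operator has a kernel vector (`mem_relBoundary_channels_iff`).

Let `J = choi F`, and suppose a boundary channel `G` occurs in `F` with weight `1 - b`. The rest `K
= J - (1 - b) choi G` is positive semidefinite with partial trace `(b/d) I`, and `K v = J v` for a
kernel vector `v` of `choi G`. Cauchy–Schwarz for `K` gives `s K ≥ |Jv⟩⟨Jv|` with `s = ⟨v|J|v⟩`.
Writing `J v = |A⟩⟩` and taking partial traces gives `A†A ≤ (s b/d) I`, while `⟨⟨A|J⁻¹|A⟩⟩ = s`. If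
`N` is the maximum of `⟨⟨A|J⁻¹|A⟩⟩` over contractions, scaling yields `s ≤ (s b/d) N`, that is `b ≥
d/N` (`IsContractionMax.le_of_mulVec_eq`).

A positive definite form is maximal on contractions only at unitaries, since any other contraction
is the midpoint of a nontrivial segment of contractions (`exists_unitary_forall_contraction_le`).
Hence `N` is the maximum over unitaries, and equality in the bound forces `K = b choi W` with `W`
unitary. Conversely, subtracting `(d/N) choi U` from `J` at a maximizing `U` leaves a singular
positive semidefinite matrix, so the bound is attained (`boundariness_eq_inv`). -/

theorem vecOf_apply {d : ℕ} (U : Op d) (p : Fin d × Fin d) : vecOf U p = U p.1 p.2 := by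
  obtain ⟨a, j⟩ := p
  simp only [vecOf, Matrix.mulVec, dotProduct, Matrix.kroneckerMap_apply, Finset.sum_apply,
    Pi.single_apply, Fintype.sum_prod_type, Matrix.one_apply, Prod.mk.injEq]
  rw [Finset.sum_eq_single j]
  · rw [Finset.sum_eq_single j]
    · simp
    · intro b _ hb
      simp [hb.symm]
    · simp
  · intro b _ hb
    refine Finset.sum_eq_zero fun c _ => ?_
    by_cases hc : j = c
    · subst hc
      simp [Ne.symm hb]
    · simp [hc]
  · simp

theorem choi_apply {d : ℕ} (Φ : SuperOp d) (a j b k : Fin d) :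
    choi Φ (a, j) (b, k) = (1 / (d : ℂ)) * Φ (Matrix.single j k 1) a b := by
  simp only [choi, Matrix.smul_apply, Matrix.sum_apply, Matrix.kroneckerMap_apply, smul_eq_mul]
  congr 1
  rw [Finset.sum_eq_single j, Finset.sum_eq_single k]
  · simp
  · intro x _ hx
    simp [hx]
  · simp
  · intro x _ hx
    refine Finset.sum_eq_zero fun c _ => ?_
    simp [hx]
  · simp

theorem choi_add {d : ℕ} (Φ Ψ : SuperOp d) : choi (Φ + Ψ) = choi Φ + choi Ψ := by
  ext ⟨a, j⟩ ⟨b, k⟩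
  simp [choi_apply, mul_add]

theorem choi_smul {d : ℕ} (r : ℝ) (Φ : SuperOp d) : choi (r • Φ) = r • choi Φ := by
  ext ⟨a, j⟩ ⟨b, k⟩
  simp [choi_apply]
  ring

/-- The Choi operator as a real linear map. -/
noncomputable def choiLinear (d : ℕ) :
    SuperOp d →ₗ[ℝ] Matrix (Fin d × Fin d) (Fin d × Fin d) ℂ where
  toFun := choi
  map_add' := choi_add
  map_smul' := choi_smul

theorem choi_sub {d : ℕ} (Φ Ψ : SuperOp d) : choi (Φ - Ψ) = choi Φ - choi Ψ :=
  map_sub (choiLinear d) Φ Ψ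

theorem choi_sum {d : ℕ} {ι : Type*} (s : Finset ι) (Φ : ι → SuperOp d) :
    choi (∑ i ∈ s, Φ i) = ∑ i ∈ s, choi (Φ i) :=
  map_sum (choiLinear d) Φ s

theorem choi_injective {d : ℕ} : Function.Injective (choi (d := d)) := by
  intro Φ Ψ h
  have h1 : (Φ : Op d →ₗ[ℂ] Op d) = Ψ := by
    refine Matrix.ext_linearMap ℂ fun j k => ?_
    ext a b
    have hd : (d : ℂ) ≠ 0 := by
      have : 0 < d := j.pos
      exact_mod_cast this.ne'
    have h2 := congrFun (congrFun h (a, j)) (b, k)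
    rw [choi_apply, choi_apply] at h2
    simpa [hd, Matrix.singleLinearMap] using h2
  exact ContinuousLinearMap.coe_injective h1

theorem continuous_choi {d : ℕ} : Continuous (choi (d := d)) := by
  refine continuous_matrix fun p q => ?_
  obtain ⟨a, j⟩ := p
  obtain ⟨b, k⟩ := q
  simp only [choi_apply]
  exact continuous_const.mul ((continuous_eval_const _).matrix_elem a b)

theorem choi_apply_of_kraus {d : ℕ} {ι : Type*} [Fintype ι] {A : ι → Op d} {Φ : SuperOp d}
    (h : ∀ X : Op d, Φ X = ∑ l, A l * X * (A l)ᴴ) (a j b k : Fin d) :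
    choi Φ (a, j) (b, k) = (1 / (d : ℂ)) * ∑ l, A l a j * star (A l b k) := by
  rw [choi_apply, h, Matrix.sum_apply]
  congr 1
  refine Finset.sum_congr rfl fun l _ => ?_
  simp [Matrix.mul_apply, Matrix.single_apply, ite_and]

theorem choi_of_kraus {d : ℕ} {ι : Type*} [Fintype ι] {A : ι → Op d} {Φ : SuperOp d}
    (h : ∀ X : Op d, Φ X = ∑ l, A l * X * (A l)ᴴ) :
    choi Φ = (1 / (d : ℝ)) • ∑ l, Matrix.vecMulVec (vecOf (A l)) (star (vecOf (A l))) := by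
  ext ⟨a, j⟩ ⟨b, k⟩
  rw [choi_apply_of_kraus h]
  simp [Matrix.sum_apply, Matrix.vecMulVec_apply, vecOf_apply]

theorem choi_conjMap {d : ℕ} (U : Op d) :
    choi (conjMap U) = (1 / (d : ℝ)) • Matrix.vecMulVec (vecOf U) (star (vecOf U)) := by
  have := choi_of_kraus (Φ := conjMap U) (A := fun _ : Unit => U) (by intro X; simp [conjMap])
  simpa using this

/-- The partial trace over the first factor. -/
noncomputable def partialTrace {d : ℕ} (M : Matrix (Fin d × Fin d) (Fin d × Fin d) ℂ) : Op d :=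
  ∑ a, M.submatrix (fun j => (a, j)) (fun j => (a, j))

theorem partialTrace_add {d : ℕ} (M N : Matrix (Fin d × Fin d) (Fin d × Fin d) ℂ) :
    partialTrace (M + N) = partialTrace M + partialTrace N := by
  ext j k
  simp [partialTrace, Matrix.sum_apply, Finset.sum_add_distrib]

theorem partialTrace_sub {d : ℕ} (M N : Matrix (Fin d × Fin d) (Fin d × Fin d) ℂ) :
    partialTrace (M - N) = partialTrace M - partialTrace N := by
  ext j k
  simp [partialTrace, Matrix.sum_apply]

theorem partialTrace_smul {d : ℕ} (r : ℝ) (M : Matrix (Fin d × Fin d) (Fin d × Fin d) ℂ) :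
    partialTrace (r • M) = r • partialTrace M := by
  ext j k
  simp [partialTrace, Matrix.sum_apply, Finset.mul_sum]

theorem trace_partialTrace {d : ℕ} (M : Matrix (Fin d × Fin d) (Fin d × Fin d) ℂ) :
    (partialTrace M).trace = M.trace := by
  simp [partialTrace, Matrix.trace, Matrix.sum_apply, Fintype.sum_prod_type]
  rw [Finset.sum_comm]

theorem Matrix.PosSemidef.partialTrace {d : ℕ} {M : Matrix (Fin d × Fin d) (Fin d × Fin d) ℂ}
    (hM : M.PosSemidef) : (_root_.partialTrace M).PosSemidef :=
  Matrix.posSemidef_sum _ fun _ _ => hM.submatrix _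

theorem partialTrace_vecMulVec {d : ℕ} (A : Op d) :
    partialTrace (Matrix.vecMulVec (vecOf A) (star (vecOf A))) = (Aᴴ * A)ᵀ := by
  ext j k
  simp [partialTrace, Matrix.sum_apply, Matrix.vecMulVec_apply, vecOf_apply, Matrix.mul_apply,
    mul_comm]

theorem partialTrace_of_kraus {d : ℕ} {ι : Type*} [Fintype ι] {A : ι → Op d} {Φ : SuperOp d}
    (h : ∀ X : Op d, Φ X = ∑ l, A l * X * (A l)ᴴ) :
    partialTrace (choi Φ) = (1 / (d : ℝ)) • (∑ l, (A l)ᴴ * A l)ᵀ := by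
  ext j k
  simp [partialTrace, Matrix.sum_apply, choi_apply_of_kraus h, Matrix.mul_apply,
    ← Finset.mul_sum, Matrix.transpose_apply]
  rw [Finset.sum_comm]
  simp [mul_comm]

/-- Factor the Choi operator as `B* B`: the conjugated rows of `B`, reshaped into `d × d` matrices
and multiplied by `√d` to cancel the `1/d` in `choi`, are Kraus operators. -/
theorem exists_kraus_of_posSemidef {d : ℕ} {Φ : SuperOp d} (h : (choi Φ).PosSemidef) :
    ∃ A : Fin d × Fin d → Op d, ∀ X : Op d, Φ X = ∑ l, A l * X * (A l)ᴴ := by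
  obtain ⟨B, hB⟩ := CStarAlgebra.nonneg_iff_eq_star_mul_self.mp
    (Matrix.nonneg_iff_posSemidef.mpr h)
  let A : Fin d × Fin d → Op d := fun l =>
    Matrix.of fun a j => (Real.sqrt d : ℂ) * star (B l (a, j))
  refine ⟨A, ?_⟩
  let Ψ : Op d →ₗ[ℂ] Op d :=
    ∑ l, (LinearMap.mulRight ℂ (A l)ᴴ) ∘ₗ (LinearMap.mulLeft ℂ (A l))
  have hΨ : ∀ X, Ψ.toContinuousLinearMap X = ∑ l, A l * X * (A l)ᴴ := by
    intro X
    simp [Ψ]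
  have : Φ = Ψ.toContinuousLinearMap := by
    apply choi_injective
    ext ⟨a, j⟩ ⟨b, k⟩
    rw [choi_apply_of_kraus hΨ, hB]
    have hd : (d : ℂ) ≠ 0 := by
      have : 0 < d := j.pos
      exact_mod_cast this.ne'
    have hs : (Real.sqrt d : ℂ) * (Real.sqrt d : ℂ) = d := by
      rw [← Complex.ofReal_mul, Real.mul_self_sqrt (Nat.cast_nonneg d)]
      simp
    rw [Matrix.star_eq_conjTranspose, Matrix.mul_apply, Finset.mul_sum]
    refine Finset.sum_congr rfl fun l _ => ?_
    simp only [A, Matrix.of_apply, Matrix.conjTranspose_apply, star_mul', star_star]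
    have h3 : star (Real.sqrt d : ℂ) = (Real.sqrt d : ℂ) := Complex.conj_ofReal _
    rw [h3]
    field_simp
    linear_combination (-(star (B l (a, j)) * B l (b, k))) * hs
  intro X
  rw [this, hΨ]

theorem mem_channels_iff {d : ℕ} (hd : 0 < d) (Φ : SuperOp d) :
    Φ ∈ channels d ↔
      (choi Φ).PosSemidef ∧ partialTrace (choi Φ) = (1 / (d : ℝ)) • (1 : Op d) := by
  constructor
  · rintro ⟨m, A, hA, h⟩
    refine ⟨?_, ?_⟩
    · rw [choi_of_kraus h]
      refine Matrix.PosSemidef.smul (Matrix.posSemidef_sum _ fun l _ => ?_) (by positivity)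
      exact Matrix.posSemidef_vecMulVec_self_star _
    · rw [partialTrace_of_kraus h, hA, Matrix.transpose_one]
  · rintro ⟨h1, h2⟩
    obtain ⟨A, hA⟩ := exists_kraus_of_posSemidef h1
    rw [partialTrace_of_kraus hA] at h2
    have hd' : (1 / (d : ℝ)) ≠ 0 := by positivity
    have h3 : ∑ l, (A l)ᴴ * A l = 1 := by
      have := smul_right_injective (Op d) hd' h2
      rw [← Matrix.transpose_transpose (∑ l, (A l)ᴴ * A l), this, Matrix.transpose_one]
    let e := Fintype.equivFin (Fin d × Fin d)
    refine ⟨_, fun l => A (e.symm l), ?_, fun X => ?_⟩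
    · rw [← h3]
      exact e.symm.sum_comp fun l => (A l)ᴴ * A l
    · rw [hA]
      exact (e.symm.sum_comp fun l => A l * X * (A l)ᴴ).symm

theorem trace_choi_of_mem {d : ℕ} (hd : 0 < d) {Φ : SuperOp d} (h : Φ ∈ channels d) :
    (choi Φ).trace = 1 := by
  rw [← trace_partialTrace, ((mem_channels_iff hd Φ).mp h).2]
  have : (d : ℂ) ≠ 0 := by exact_mod_cast hd.ne'
  simp [this]

theorem conjMap_mem_channels {d : ℕ} (U : Matrix.unitaryGroup (Fin d) ℂ) :
    conjMap (U : Op d) ∈ channels d := by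
  refine ⟨1, fun _ => U, ?_, fun X => ?_⟩
  · simpa [Matrix.star_eq_conjTranspose] using Matrix.UnitaryGroup.star_mul_self U
  · simp [conjMap]

/-! ### Relative interior and boundary of the set of channels -/

/-- The line from `y` through `x` lies in the affine span, so a neighbourhood of `x` in that span
contains points of the line slightly beyond `x`. -/
theorem exists_pos_add_smul_sub_mem {V : Type*} [AddCommGroup V] [Module ℝ V]
    [TopologicalSpace V] [IsTopologicalAddGroup V] [ContinuousSMul ℝ V] {B : Set V} {x y : V}
    (hx : x ∈ intrinsicInterior ℝ B) (hy : y ∈ B) : ∃ ε : ℝ, 0 < ε ∧ x + ε • (x - y) ∈ B := by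
  have hxB : x ∈ B := intrinsicInterior_subset hx
  obtain ⟨z, hz, rfl⟩ := mem_intrinsicInterior.mp hx
  let f : ℝ → affineSpan ℝ B := fun t =>
    ⟨AffineMap.lineMap (z : V) y (-t),
      AffineMap.lineMap_mem _ z.2 (subset_affineSpan ℝ B hy)⟩
  have hf : Continuous f := by
    refine Continuous.subtype_mk ?_ _
    simp only [AffineMap.lineMap_apply, vsub_eq_sub, vadd_eq_add]
    fun_prop
  have h0 : f 0 = z := by
    ext
    simp [f]
  have h1 : f ⁻¹' (interior (Subtype.val ⁻¹' B)) ∈ 𝓝 (0 : ℝ) :=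
    hf.continuousAt.preimage_mem_nhds (isOpen_interior.mem_nhds (by rwa [h0]))
  obtain ⟨ε, hε, h2⟩ := Metric.mem_nhds_iff.mp h1
  refine ⟨ε / 2, by positivity, ?_⟩
  have h3 : ε / 2 ∈ Metric.ball (0 : ℝ) ε := by
    rw [Metric.mem_ball, Real.dist_eq, sub_zero, abs_of_pos (by positivity)]
    linarith
  have h5 : f (ε / 2) ∈ Subtype.val ⁻¹' B := interior_subset (h2 h3)
  have h4 : AffineMap.lineMap (z : V) y (-(ε / 2)) ∈ B := h5
  rw [AffineMap.lineMap_apply, vsub_eq_sub, vadd_eq_add] at h4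
  convert h4 using 1
  module

instance SuperOp.continuousSMul_real (d : ℕ) : ContinuousSMul ℝ (SuperOp d) :=
  IsScalarTower.continuousSMul ℂ

/-- The completely depolarizing channel. -/
noncomputable def depolarizing (d : ℕ) : SuperOp d :=
  LinearMap.toContinuousLinearMap
    ((Matrix.traceLinearMap (Fin d) ℂ ℂ).smulRight ((1 / (d : ℂ)) • (1 : Op d)))

theorem choi_depolarizing (d : ℕ) :
    choi (depolarizing d) = ((1 / (d : ℝ)) ^ 2) •
      (1 : Matrix (Fin d × Fin d) (Fin d × Fin d) ℂ) := by
  ext ⟨a, j⟩ ⟨b, k⟩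
  rw [choi_apply]
  by_cases h1 : a = b <;> by_cases h2 : j = k <;>
    simp [depolarizing, h1, h2, Matrix.trace_single_eq_of_ne]
  ring

theorem depolarizing_mem_channels {d : ℕ} (hd : 0 < d) : depolarizing d ∈ channels d := by
  rw [mem_channels_iff hd, choi_depolarizing]
  refine ⟨Matrix.PosSemidef.smul .one (by positivity), ?_⟩
  rw [partialTrace_smul]
  have h : partialTrace (1 : Matrix (Fin d × Fin d) (Fin d × Fin d) ℂ) = (d : ℝ) • (1 : Op d) := by
    ext j k
    simp [partialTrace, Matrix.sum_apply, Matrix.one_apply]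
  rw [h, smul_smul]
  congr 1
  have : (d : ℝ) ≠ 0 := by positivity
  field_simp

/-- `F` lies strictly between the depolarizing channel and a channel slightly beyond `F`; the former
contributes a positive multiple of the identity, the latter a positive semidefinite term. -/
theorem posDef_choi_of_mem_intrinsicInterior {d : ℕ} (hd : 0 < d) {F : SuperOp d}
    (hF : F ∈ intrinsicInterior ℝ (channels d)) : (choi F).PosDef := by
  obtain ⟨ε, hε, h⟩ := exists_pos_add_smul_sub_mem hF (depolarizing_mem_channels hd)
  have h1 := ((mem_channels_iff hd _).mp h).1
  have h2 : choi F = (1 / (1 + ε)) • ((ε * (1 / (d : ℝ)) ^ 2) •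
      (1 : Matrix (Fin d × Fin d) (Fin d × Fin d) ℂ)
        + choi (F + ε • (F - depolarizing d))) := by
    rw [choi_add, choi_smul, choi_sub, choi_depolarizing]
    have : 1 + ε ≠ 0 := by positivity
    match_scalars <;> field_simp
    ring
  rw [h2]
  refine Matrix.PosDef.smul (Matrix.PosDef.add_posSemidef ?_ h1) (by positivity)
  exact Matrix.PosDef.smul .one (by positivity)

/-- The complement is the projection of a closed set along the compact sphere, hence closed. The
real part is taken because `M` need not be Hermitian. -/
theorem isOpen_setOf_forall_sphere_pos {ι : Type*} [Fintype ι] :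
    IsOpen {M : Matrix ι ι ℂ | ∀ x ∈ Metric.sphere (0 : ι → ℂ) 1, 0 < (star x ⬝ᵥ (M *ᵥ x)).re} := by
  rw [← isClosed_compl_iff]
  let S := Metric.sphere (0 : ι → ℂ) 1
  have : CompactSpace S := isCompact_iff_compactSpace.mp (isCompact_sphere _ _)
  have hcl : IsClosed {p : S × Matrix ι ι ℂ | (star (p.1 : ι → ℂ) ⬝ᵥ (p.2 *ᵥ p.1)).re ≤ 0} := by
    refine isClosed_le (Complex.continuous_re.comp ?_) continuous_const
    have h1 : Continuous fun p : S × Matrix ι ι ℂ => (p.1 : ι → ℂ) :=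
      continuous_subtype_val.comp continuous_fst
    exact h1.star.dotProduct (continuous_snd.matrix_mulVec h1)
  convert isClosedMap_snd_of_compactSpace _ hcl using 1
  ext M
  simp only [Set.mem_compl_iff, Set.mem_ofPred_eq, Set.mem_image, Prod.exists, exists_eq_right,
    Subtype.exists, not_forall, not_lt, S]

theorem Matrix.IsHermitian.posDef_of_forall_sphere_pos {ι : Type*} [Fintype ι] {M : Matrix ι ι ℂ}
    (hM : M.IsHermitian)
    (h : ∀ x ∈ Metric.sphere (0 : ι → ℂ) 1, 0 < (star x ⬝ᵥ (M *ᵥ x)).re) : M.PosDef := by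
  refine .of_dotProduct_mulVec_pos hM fun x hx => ?_
  have hn : 0 < ‖x‖ := norm_pos_iff.mpr hx
  have h1 := h ((‖x‖⁻¹ : ℂ) • x) (by simp [norm_smul, hn.ne'])
  have h2 : star ((‖x‖⁻¹ : ℂ) • x) ⬝ᵥ (M *ᵥ ((‖x‖⁻¹ : ℂ) • x))
      = ((‖x‖⁻¹ * ‖x‖⁻¹ : ℝ) : ℂ) * (star x ⬝ᵥ (M *ᵥ x)) := by
    rw [Matrix.mulVec_smul, star_smul, smul_dotProduct, dotProduct_smul]
    simp
    ring
  rw [h2, Complex.re_ofReal_mul] at h1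
  have h3 : 0 < (star x ⬝ᵥ (M *ᵥ x)).re := by
    by_contra! hc
    have : 0 ≤ ‖x‖⁻¹ * ‖x‖⁻¹ := by positivity
    nlinarith
  exact Complex.pos_iff.mpr ⟨h3, by simpa using (hM.im_star_dotProduct_mulVec_self x).symm⟩

/-- Hermiticity and the partial trace condition are affine, so within the affine span positivity is
all that remains to be checked for being a channel. -/
theorem mem_affineSpan_channels {d : ℕ} (hd : 0 < d) {H : SuperOp d}
    (hH : H ∈ affineSpan ℝ (channels d)) :
    (choi H).IsHermitian ∧ partialTrace (choi H) = (1 / (d : ℝ)) • (1 : Op d) := by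
  refine affineSpan_induction hH (fun x hx => ?_) fun c u v w hu hv hw => ?_
  · have := (mem_channels_iff hd x).mp hx
    exact ⟨this.1.1, this.2⟩
  · rw [vsub_eq_sub, vadd_eq_add, choi_add, choi_smul, choi_sub]
    refine ⟨?_, ?_⟩
    · refine Matrix.IsHermitian.add ?_ hw.1
      rw [Matrix.IsHermitian, Matrix.conjTranspose_smul, star_trivial, (hu.1.sub hv.1).eq]
    · rw [partialTrace_add, partialTrace_smul, partialTrace_sub, hu.2, hv.2, hw.2]
      simp

theorem mem_intrinsicInterior_of_posDef_choi {d : ℕ} (hd : 0 < d) {G : SuperOp d}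
    (hG : G ∈ channels d) (hpos : (choi G).PosDef) : G ∈ intrinsicInterior ℝ (channels d) := by
  refine mem_intrinsicInterior.mpr ⟨⟨G, subset_affineSpan ℝ _ hG⟩, ?_, rfl⟩
  refine mem_interior.mpr ⟨_, ?_, isOpen_setOf_forall_sphere_pos.preimage
    (continuous_choi.comp continuous_subtype_val), ?_⟩
  · intro H hH
    have h := mem_affineSpan_channels hd H.2
    exact (mem_channels_iff hd _).mpr ⟨(h.1.posDef_of_forall_sphere_pos hH).posSemidef, h.2⟩
  · intro x hx
    refine hpos.re_dotProduct_pos ?_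
    rintro rfl
    simp at hx

theorem mem_relBoundary_channels_iff {d : ℕ} (hd : 0 < d) (G : SuperOp d) :
    G ∈ relBoundary (channels d) ↔ G ∈ channels d ∧ ∃ v, v ≠ 0 ∧ choi G *ᵥ v = 0 := by
  have key : G ∈ channels d →
      ((∃ v, v ≠ 0 ∧ choi G *ᵥ v = 0) ↔ G ∉ intrinsicInterior ℝ (channels d)) := by
    intro hG
    rw [Matrix.exists_mulVec_eq_zero_iff, ← not_iff_not, not_not,
      ← ne_eq, ← ((mem_channels_iff hd G).mp hG).1.posDef_iff_det_ne_zero]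
    exact ⟨mem_intrinsicInterior_of_posDef_choi hd hG, posDef_choi_of_mem_intrinsicInterior hd⟩
  constructor
  · rintro ⟨h1, h2⟩
    exact ⟨h1, (key h1).mpr h2⟩
  · rintro ⟨h1, h2⟩
    exact ⟨h1, (key h1).mp h2⟩

/-! ### Maximizing a positive quadratic form over contractions -/

/-- Cauchy–Schwarz for the form `K`: `|⟨x, K v⟩|² ≤ ⟨v, K v⟩ ⟨x, K x⟩`. It follows from the
congruence `T† K T = s (s K - |u⟩⟨u|)` with `T = s I - |v⟩⟨u|`. -/
theorem Matrix.PosSemidef.smul_sub_vecMulVec {ι : Type*} [Fintype ι] [DecidableEq ι]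
    {K : Matrix ι ι ℂ} (hK : K.PosSemidef) {u v : ι → ℂ} (hu : K *ᵥ v = u) {s : ℝ}
    (hs : star v ⬝ᵥ u = s) (hs0 : 0 < s) :
    (s • K - Matrix.vecMulVec u (star u)).PosSemidef := by
  let T : Matrix ι ι ℂ := s • 1 - Matrix.vecMulVec v (star u)
  have hvK : star v ᵥ* K = star u := by
    rw [← hu, Matrix.star_mulVec, hK.1.eq]
  have h1 : K * T = s • K - Matrix.vecMulVec u (star u) := by
    simp only [T, Matrix.mul_sub, Matrix.mul_vecMulVec, hu, Matrix.mul_smul, Matrix.mul_one]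
  have h2 : Tᴴ = s • 1 - Matrix.vecMulVec u (star v) := by
    simp [T, Matrix.conjTranspose_vecMulVec]
  have h3 : Tᴴ * K * T = s • (s • K - Matrix.vecMulVec u (star u)) := by
    rw [Matrix.mul_assoc, h1, h2]
    simp only [Matrix.mul_sub, Matrix.sub_mul, Matrix.smul_mul, Matrix.mul_smul, Matrix.one_mul,
      Matrix.vecMulVec_mul_vecMulVec, hs, smul_sub]
    rw [Matrix.vecMulVec_mul, hvK]
    have : Matrix.vecMulVec u ((s : ℂ) • star u) = s • Matrix.vecMulVec u (star u) := by
      rw [Matrix.vecMulVec_smul]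
      rfl
    rw [this]
    abel
  have h4 : s • K - Matrix.vecMulVec u (star u) = s⁻¹ • (Tᴴ * K * T) := by
    rw [h3, smul_smul, inv_mul_cancel₀ hs0.ne', one_smul]
  rw [h4]
  exact (hK.conjTranspose_mul_mul_same T).smul (by positivity)

/-- A contraction that is not an isometry is not extreme. If `A` is singular, `B` is a partial
isometry from a line in `ker A` to a line in `ker A†`. If `A` is invertible, `B` is half of `A P`
with `P = 1 - A†A`. -/
theorem exists_perturbation_of_conjTranspose_mul_self_ne_one {ι : Type*} [Fintype ι]
    [DecidableEq ι] {A : Matrix ι ι ℂ} (hA : (1 - Aᴴ * A).PosSemidef) (h : Aᴴ * A ≠ 1) :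
    ∃ B : Matrix ι ι ℂ, B ≠ 0 ∧ (1 - (A + B)ᴴ * (A + B)).PosSemidef ∧
      (1 - (A - B)ᴴ * (A - B)).PosSemidef := by
  by_cases hdet : A.det = 0
  · obtain ⟨v, hv0, hv⟩ := Matrix.exists_mulVec_eq_zero_iff.mpr hdet
    obtain ⟨w, hw0, hw⟩ := Matrix.exists_mulVec_eq_zero_iff (M := Aᴴ).mpr
      (by rw [Matrix.det_conjTranspose, hdet, star_zero])
    have hvpos : 0 < star v ⬝ᵥ v := Matrix.dotProduct_star_self_pos_iff.mpr hv0
    have hwpos : 0 < star w ⬝ᵥ w := Matrix.dotProduct_star_self_pos_iff.mpr hw0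
    obtain ⟨p, hp⟩ : ∃ r : ℝ, (r : ℂ) = star v ⬝ᵥ v :=
      ⟨_, Complex.ext rfl (Complex.pos_iff.mp hvpos).2⟩
    have hp0 : 0 < p := by
      rw [← hp] at hvpos
      exact_mod_cast hvpos
    obtain ⟨q, hq⟩ : ∃ r : ℝ, (r : ℂ) = star w ⬝ᵥ w :=
      ⟨_, Complex.ext rfl (Complex.pos_iff.mp hwpos).2⟩
    have hq0 : 0 < q := by
      rw [← hq] at hwpos
      exact_mod_cast hwpos
    -- This normalization makes `B†B` the orthogonal projection onto the line of `v`.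
    let c : ℝ := (Real.sqrt p)⁻¹ * (Real.sqrt q)⁻¹
    have hc : c * c = p⁻¹ * q⁻¹ := by
      have h1 := Real.mul_self_sqrt hp0.le
      have h2 := Real.mul_self_sqrt hq0.le
      calc c * c = (Real.sqrt p * Real.sqrt p)⁻¹ * (Real.sqrt q * Real.sqrt q)⁻¹ := by
            simp only [c, mul_inv]; ring
        _ = _ := by rw [h1, h2]
    have hc0 : c ≠ 0 := by positivity
    let B : Matrix ι ι ℂ := c • Matrix.vecMulVec w (star v)
    have hAB : Aᴴ * B = 0 := by
      simp [B, Matrix.mul_vecMulVec, hw]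
    have hBA : Bᴴ * A = 0 := by
      rw [← Matrix.conjTranspose_conjTranspose A, ← Matrix.conjTranspose_mul, hAB,
        Matrix.conjTranspose_zero]
    obtain ⟨E, hE⟩ : ∃ E : Matrix ι ι ℂ, E = 1 - p⁻¹ • Matrix.vecMulVec v (star v) := ⟨_, rfl⟩
    have hBB : Bᴴ * B = p⁻¹ • Matrix.vecMulVec v (star v) := by
      simp only [B, Matrix.conjTranspose_smul, star_trivial, Matrix.conjTranspose_vecMulVec,
        star_star, Matrix.smul_mul, Matrix.mul_smul, Matrix.vecMulVec_mul_vecMulVec, smul_smul,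
        hc, ← hq, Matrix.vecMulVec_smul]
      rw [← Complex.coe_smul (p⁻¹ * q⁻¹), ← Complex.coe_smul p⁻¹, smul_smul]
      congr 1
      push_cast
      have : (q : ℂ) ≠ 0 := by exact_mod_cast hq0.ne'
      field_simp
    have hEh : Eᴴ = E := by
      simp [hE, Matrix.conjTranspose_vecMulVec]
    have hAE : A * E = A := by
      simp [hE, Matrix.mul_sub, Matrix.mul_vecMulVec, hv]
    have hEA : E * Aᴴ = Aᴴ := by
      rw [← hEh, ← Matrix.conjTranspose_mul, hAE]
    have hEE : E * E = E := by
      have : Matrix.vecMulVec v (star v) * Matrix.vecMulVec v (star v)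
          = p • Matrix.vecMulVec v (star v) := by
        rw [Matrix.vecMulVec_mul_vecMulVec, ← hp, Matrix.vecMulVec_smul]
        rfl
      simp only [hE, Matrix.mul_sub, Matrix.sub_mul, Matrix.smul_mul, Matrix.mul_smul, this,
        Matrix.one_mul, Matrix.mul_one, smul_smul]
      rw [inv_mul_cancel₀ hp0.ne', one_smul, sub_self, smul_zero, sub_zero]
    -- `E` projects onto the complement of `v`, and compressing `1 - A†A` by it removes exactly
    -- `B†B`. The cross terms `A†B` and `B†A` vanish, so this one matrix serves both signs.
    have hpsd : (1 - Aᴴ * A - Bᴴ * B).PosSemidef := by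
      have h1 := hA.conjTranspose_mul_mul_same E
      have h2 : Eᴴ * (1 - Aᴴ * A) * E = 1 - Aᴴ * A - Bᴴ * B := by
        rw [hEh, Matrix.mul_sub, Matrix.sub_mul, Matrix.mul_one, hEE, ← Matrix.mul_assoc, hEA,
          Matrix.mul_assoc, hAE, hBB]
        simp only [hE]
        abel
      rwa [h2] at h1
    refine ⟨B, ?_, ?_, ?_⟩
    · intro hB
      have h1 : Matrix.vecMulVec w (star v) = 0 := by
        simpa [B, hc0] using hB
      rcases Matrix.vecMulVec_eq_zero.mp h1 with h | h
      · exact hw0 h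
      · exact hv0 (by simpa using h)
    · convert hpsd using 1
      simp only [Matrix.conjTranspose_add, Matrix.mul_add, Matrix.add_mul, hAB, hBA]
      abel
    · convert hpsd using 1
      simp only [Matrix.conjTranspose_sub, Matrix.mul_sub, Matrix.sub_mul, hAB, hBA]
      abel
  · let P : Matrix ι ι ℂ := 1 - Aᴴ * A
    have hPh : Pᴴ = P := hA.1
    have hAA : Aᴴ * A = 1 - P := by simp [P]
    have hP : P.PosSemidef := hA
    have hP2 : (P * P).PosSemidef := by
      have := Matrix.posSemidef_conjTranspose_mul_self P
      rwa [hPh] at this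
    have hP3 : (P * P * P).PosSemidef := by
      have := hP.conjTranspose_mul_mul_same P
      rwa [hPh] at this
    have hQ : (1 - P).PosSemidef := hAA ▸ Matrix.posSemidef_conjTranspose_mul_self A
    -- `P - P² = P (1 - P) P + (1 - P) P (1 - P)`.
    have hPQ : (P - P * P).PosSemidef := by
      have h1 := hQ.conjTranspose_mul_mul_same P
      have h2 := hP.conjTranspose_mul_mul_same (1 - P)
      rw [hQ.1.eq] at h2
      rw [hPh] at h1
      convert h1.add h2 using 1
      noncomm_ring
    have hadj : ∀ r : ℝ, (A + r • (A * P))ᴴ * (A + r • (A * P))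
        = (1 + r • P) * (1 - P) * (1 + r • P) := by
      intro r
      rw [← hAA, Matrix.conjTranspose_add, Matrix.conjTranspose_smul, Matrix.conjTranspose_mul, hPh,
        star_trivial]
      simp only [Matrix.add_mul, Matrix.mul_add, Matrix.smul_mul, Matrix.mul_smul, Matrix.one_mul,
        Matrix.mul_one, Matrix.mul_assoc]
    refine ⟨(1 / 2 : ℝ) • (A * P), ?_, ?_, ?_⟩
    · intro h0
      have h1 : A * P = 0 := by simpa using h0
      have h2 : P = 0 := by
        have := congrArg (A⁻¹ * ·) h1
        simpa [← Matrix.mul_assoc, Matrix.nonsing_inv_mul A (isUnit_iff_ne_zero.mpr hdet)]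
          using this
      exact h (by rw [hAA, h2, sub_zero])
    · rw [hadj]
      have : 1 - (1 + (1 / 2 : ℝ) • P) * (1 - P) * (1 + (1 / 2 : ℝ) • P)
          = (3 / 4 : ℝ) • (P * P) + (1 / 4 : ℝ) • (P * P * P) := by
        simp only [Matrix.add_mul, Matrix.mul_add, Matrix.sub_mul, Matrix.mul_sub, Matrix.smul_mul,
          Matrix.mul_smul, Matrix.one_mul, Matrix.mul_one]
        module
      rw [this]
      exact (hP2.smul (by norm_num)).add (hP3.smul (by norm_num))
    · have h1 := hadj (-(1 / 2))
      rw [neg_smul, ← sub_eq_add_neg] at h1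
      rw [h1]
      have : 1 - (1 + (-(1 / 2 : ℝ)) • P) * (1 - P) * (1 + (-(1 / 2 : ℝ)) • P)
          = (2 : ℝ) • (P - P * P) + ((3 / 4 : ℝ) • (P * P) + (1 / 4 : ℝ) • (P * P * P)) := by
        simp only [Matrix.add_mul, Matrix.mul_add, Matrix.sub_mul, Matrix.mul_sub, Matrix.smul_mul,
          Matrix.mul_smul, Matrix.one_mul, Matrix.mul_one]
        module
      rw [this]
      exact (hPQ.smul (by norm_num)).add ((hP2.smul (by norm_num)).add (hP3.smul (by norm_num)))

/-- The diagonal of `1 - A†A` bounds every column norm by 1; closedness is an intersection of closed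
conditions, one for each vector. -/
theorem isCompact_setOf_contraction (ι : Type*) [Fintype ι] [DecidableEq ι] :
    IsCompact {A : Matrix ι ι ℂ | (1 - Aᴴ * A).PosSemidef} := by
  have hK : IsCompact (Set.pi Set.univ fun _ : ι => Set.pi Set.univ fun _ : ι =>
      Metric.closedBall (0 : ℂ) 1) :=
    isCompact_univ_pi fun _ => isCompact_univ_pi fun _ => isCompact_closedBall _ _
  refine IsCompact.of_isClosed_subset hK ?_ ?_
  · have h1 : {A : Matrix ι ι ℂ | (1 - Aᴴ * A).PosSemidef} =
        ⋂ x : ι → ℂ, {A : Matrix ι ι ℂ | 0 ≤ star x ⬝ᵥ ((1 - Aᴴ * A) *ᵥ x)} := by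
      ext A
      simp only [Set.mem_ofPred_eq, Set.mem_iInter, Matrix.posSemidef_iff_dotProduct_mulVec]
      refine ⟨fun h => h.2, fun h => ⟨?_, h⟩⟩
      exact Matrix.isHermitian_one.sub (Matrix.isHermitian_conjTranspose_mul_self A)
    rw [h1]
    refine isClosed_iInter fun x => isClosed_le continuous_const ?_
    fun_prop
  · intro A hA a _ j _
    have h1 := hA.diag_nonneg (i := j)
    rw [Matrix.sub_apply, Matrix.one_apply_eq, Matrix.mul_apply] at h1
    have h2 := (Complex.le_def.mp h1).1
    have h3 : ∀ b, (Aᴴ j b * A b j).re = ‖A b j‖ ^ 2 := by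
      intro b
      rw [Matrix.conjTranspose_apply, ← Complex.normSq_eq_norm_sq]
      simp [Complex.normSq_apply]
    rw [Complex.sub_re, Complex.re_sum] at h2
    simp only [h3] at h2
    have h4 := Finset.single_le_sum (f := fun b => ‖A b j‖ ^ 2) (fun b _ => sq_nonneg _)
      (Finset.mem_univ a)
    simp at h2 h4
    rw [mem_closedBall_zero_iff]
    refine (sq_le_one_iff₀ (norm_nonneg _)).mp ?_
    linarith

theorem vecOf_add {d : ℕ} (A B : Op d) : vecOf (A + B) = vecOf A + vecOf B := by
  ext p
  simp [vecOf_apply]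

theorem vecOf_sub {d : ℕ} (A B : Op d) : vecOf (A - B) = vecOf A - vecOf B := by
  ext p
  simp [vecOf_apply]

theorem vecOf_smul {d : ℕ} (r : ℝ) (A : Op d) : vecOf (r • A) = r • vecOf A := by
  ext p
  simp [vecOf_apply]

theorem vecOf_eq_zero_iff {d : ℕ} {A : Op d} : vecOf A = 0 ↔ A = 0 := by
  refine ⟨fun h => ?_, fun h => ?_⟩
  · ext a j
    simpa [vecOf_apply] using congrFun h (a, j)
  · ext p
    simp [h, vecOf_apply]

/-- Compactness gives a maximizer. If a maximizer `A` were not unitary, with `A ± B` contractions,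
the parallelogram law would make the form at one of them exceed the maximum by at least its value at
`B`, which is positive. -/
theorem exists_unitary_forall_contraction_le {d : ℕ}
    {Q : Matrix (Fin d × Fin d) (Fin d × Fin d) ℂ} (hQ : Q.PosDef) :
    ∃ U : Matrix.unitaryGroup (Fin d) ℂ, ∀ A : Op d, (1 - Aᴴ * A).PosSemidef →
      (sandwich Q (vecOf A)).re ≤ (sandwich Q (vecOf (U : Op d))).re ∧
      ((sandwich Q (vecOf A)).re = (sandwich Q (vecOf (U : Op d))).re → Aᴴ * A = 1) := by
  let q : Op d → ℝ := fun A => (sandwich Q (vecOf A)).re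
  have hq : Continuous q := by
    have h1 : Continuous fun A : Op d => vecOf A := by
      refine continuous_pi fun p => ?_
      simp only [vecOf_apply]
      exact continuous_id.matrix_elem _ _
    refine Complex.continuous_re.comp ?_
    exact h1.star.dotProduct (continuous_const.matrix_mulVec h1)
  have hpar : ∀ A B, q (A + B) + q (A - B) = 2 * q A + 2 * q B := by
    intro A B
    simp only [q, vecOf_add, vecOf_sub, sandwich, Matrix.mulVec_add, Matrix.mulVec_sub, star_add,
      star_sub, add_dotProduct, sub_dotProduct, dotProduct_add, dotProduct_sub, Complex.add_re,
      Complex.sub_re]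
    ring
  obtain ⟨A₀, hA₀, hmax⟩ := (isCompact_setOf_contraction (Fin d)).exists_isMaxOn
    ⟨0, by simpa using Matrix.PosSemidef.one⟩ hq.continuousOn
  have key : ∀ A : Op d, (1 - Aᴴ * A).PosSemidef → q A₀ ≤ q A → Aᴴ * A = 1 := by
    intro A hA hle
    by_contra hne
    obtain ⟨B, hB0, h1, h2⟩ := exists_perturbation_of_conjTranspose_mul_self_ne_one hA hne
    have h3 : q (A + B) ≤ q A₀ := hmax h1
    have h4 : q (A - B) ≤ q A₀ := hmax h2
    have h5 : 0 < q B := hQ.re_dotProduct_pos (mt vecOf_eq_zero_iff.mp hB0)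
    have := hpar A B
    linarith
  refine ⟨⟨A₀, Matrix.mem_unitaryGroup_iff'.mpr (key A₀ hA₀ le_rfl)⟩, fun A hA => ⟨hmax hA, ?_⟩⟩
  intro h
  exact key A hA h.ge

/-! ### Boundariness -/

theorem Matrix.IsHermitian.sandwich_eq_ofReal {ι : Type*} [Fintype ι] {A : Matrix ι ι ℂ}
    (hA : A.IsHermitian) (v : ι → ℂ) : sandwich A v = ((sandwich A v).re : ℂ) :=
  Complex.ext rfl (by simpa using! hA.im_star_dotProduct_mulVec_self v)

theorem sandwich_real_smul {ι : Type*} [Fintype ι] (A : Matrix ι ι ℂ) (r : ℝ) (v : ι → ℂ) :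
    (sandwich A (r • v)).re = r ^ 2 * (sandwich A v).re := by
  have h : sandwich A (r • v) = ((r ^ 2 : ℝ) : ℂ) * sandwich A v := by
    simp only [sandwich, Matrix.mulVec_smul, star_smul, smul_dotProduct, dotProduct_smul,
      star_trivial, Complex.real_smul]
    push_cast
    ring
  rw [h, Complex.re_ofReal_mul]

/-- The quadratic form of `Q` on contractions is maximal at the unitary `U`, and only unitaries
attain the maximum. -/
def IsContractionMax {d : ℕ} (Q : Matrix (Fin d × Fin d) (Fin d × Fin d) ℂ) (U : Op d) : Prop :=
  ∀ A : Op d, (1 - Aᴴ * A).PosSemidef →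
    (sandwich Q (vecOf A)).re ≤ (sandwich Q (vecOf U)).re ∧
    ((sandwich Q (vecOf A)).re = (sandwich Q (vecOf U)).re → Aᴴ * A = 1)

theorem IsContractionMax.scaled {d : ℕ} {Q : Matrix (Fin d × Fin d) (Fin d × Fin d) ℂ} {U : Op d}
    (h : IsContractionMax Q U) {c : ℝ} (hc : 0 < c) {A : Op d}
    (hA : (c • (1 : Op d) - Aᴴ * A).PosSemidef) :
    (sandwich Q (vecOf A)).re ≤ c * (sandwich Q (vecOf U)).re ∧
    ((sandwich Q (vecOf A)).re = c * (sandwich Q (vecOf U)).re → Aᴴ * A = c • 1) := by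
  have hs : (Real.sqrt c)⁻¹ ^ 2 = c⁻¹ := by rw [inv_pow, Real.sq_sqrt hc.le]
  let A' := (Real.sqrt c)⁻¹ • A
  have hAA : A'ᴴ * A' = c⁻¹ • (Aᴴ * A) := by
    simp only [A', Matrix.conjTranspose_smul, star_trivial, Matrix.smul_mul, Matrix.mul_smul,
      smul_smul, ← sq, hs]
  have hA' : (1 - A'ᴴ * A').PosSemidef := by
    have : 1 - A'ᴴ * A' = c⁻¹ • (c • (1 : Op d) - Aᴴ * A) := by
      rw [hAA, smul_sub, smul_smul, inv_mul_cancel₀ hc.ne', one_smul]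
    rw [this]
    exact hA.smul (by positivity)
  have hq : (sandwich Q (vecOf A')).re = c⁻¹ * (sandwich Q (vecOf A)).re := by
    rw [vecOf_smul, sandwich_real_smul, hs]
  obtain ⟨h1, h2⟩ := h A' hA'
  rw [hq] at h1 h2
  refine ⟨(inv_mul_le_iff₀ hc).mp h1, fun he => ?_⟩
  have h3 := h2 (by rw [he, ← mul_assoc, inv_mul_cancel₀ hc.ne', one_mul])
  rw [hAA] at h3
  rw [← h3, smul_smul, mul_inv_cancel₀ hc.ne', one_smul]

theorem vecMulVec_vecOf_eq_smul_choi {d : ℕ} (hd : 0 < d) (A : Op d) :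
    Matrix.vecMulVec (vecOf A) (star (vecOf A)) = (d : ℝ) • choi (conjMap A) := by
  have : (d : ℝ) ≠ 0 := by positivity
  rw [choi_conjMap, smul_smul, mul_one_div_cancel this, one_smul]

theorem trace_vecMulVec_vecOf {d : ℕ} (A : Op d) :
    (Matrix.vecMulVec (vecOf A) (star (vecOf A))).trace = (Aᴴ * A).trace := by
  rw [← trace_partialTrace, partialTrace_vecMulVec, Matrix.trace_transpose]

/-- The core estimate and its equality case. `K` stands for what remains of `J` after a boundary
channel killing `v` has been removed, and `b` is its trace. -/
theorem IsContractionMax.le_of_mulVec_eq {d : ℕ} (hd : 0 < d)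
    {J K : Matrix (Fin d × Fin d) (Fin d × Fin d) ℂ} (hJ : J.PosDef) {U : Op d}
    (hU : IsContractionMax J⁻¹ U) (hK : K.PosSemidef) {v : Fin d × Fin d → ℂ} (hv : v ≠ 0)
    (hKv : K *ᵥ v = J *ᵥ v) {b : ℝ} (hb : partialTrace K = (b / d) • (1 : Op d)) :
    1 ≤ b * ((sandwich J⁻¹ (vecOf U)).re / d) ∧
      (b * ((sandwich J⁻¹ (vecOf U)).re / d) = 1 →
        ∃ W : Matrix.unitaryGroup (Fin d) ℂ, K = b • choi (conjMap (W : Op d))) := by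
  have hd' : (0 : ℝ) < d := by exact_mod_cast hd
  let A : Op d := Matrix.of fun a j => (J *ᵥ v) (a, j)
  have hA : vecOf A = J *ᵥ v := by
    ext p
    simp [vecOf_apply, A]
  obtain ⟨s, hs⟩ : ∃ s : ℝ, star v ⬝ᵥ (J *ᵥ v) = s := ⟨_, hJ.1.sandwich_eq_ofReal v⟩
  have hs0 : 0 < s := by
    have := hJ.dotProduct_mulVec_pos hv
    rw [hs] at this
    exact_mod_cast this
  have hJv : J⁻¹ *ᵥ (J *ᵥ v) = v := by
    rw [Matrix.mulVec_mulVec, Matrix.nonsing_inv_mul _ ((Matrix.isUnit_iff_isUnit_det _).mp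
      hJ.isUnit), Matrix.one_mulVec]
  have hA0 : A ≠ 0 := by
    rintro h0
    rw [h0, vecOf_eq_zero_iff.mpr rfl] at hA
    rw [← hA, Matrix.mulVec_zero] at hJv
    exact hv hJv.symm
  have hqA : (sandwich J⁻¹ (vecOf A)).re = s := by
    have : sandwich J⁻¹ (vecOf A) = s := by
      rw [sandwich, hA, hJv, Matrix.star_mulVec, hJ.1.eq, ← Matrix.dotProduct_mulVec, hs]
    rw [this, Complex.ofReal_re]
  have h1 : (s • K - Matrix.vecMulVec (vecOf A) (star (vecOf A))).PosSemidef :=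
    hK.smul_sub_vecMulVec (hKv.trans hA.symm) (by rw [hA, hs]) hs0
  -- The partial trace of `s K` is `c I`, so `h1` turns into `A†A ≤ c I`.
  obtain ⟨c, hc⟩ : ∃ c : ℝ, c = s * b / d := ⟨_, rfl⟩
  have h2 : (c • (1 : Op d) - Aᴴ * A).PosSemidef := by
    have := h1.partialTrace.transpose
    rw [partialTrace_sub, partialTrace_smul, hb, partialTrace_vecMulVec, Matrix.transpose_sub,
      Matrix.transpose_transpose, Matrix.transpose_smul, Matrix.transpose_smul,
      Matrix.transpose_one, smul_smul, ← mul_div_assoc, ← hc] at this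
    exact this
  have hc0 : 0 < c := by
    have h3 := h2.trace_nonneg
    have h4 : 0 < (Aᴴ * A).trace :=
      lt_of_le_of_ne (Matrix.posSemidef_conjTranspose_mul_self A).trace_nonneg
        (mt Matrix.trace_conjTranspose_mul_self_eq_zero_iff.mp hA0 ∘ Eq.symm)
    rw [Matrix.trace_sub, Matrix.trace_smul, Matrix.trace_one, Fintype.card_fin, sub_nonneg] at h3
    have h5 := h4.trans_le h3
    rw [Complex.real_smul] at h5
    have h6 : 0 < c * d := by exact_mod_cast h5
    exact pos_of_mul_pos_left h6 hd'.le
  obtain ⟨h3, h4⟩ := hU.scaled hc0 h2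
  rw [hqA] at h3 h4
  have hcN : c * (sandwich J⁻¹ (vecOf U)).re = s * (b * ((sandwich J⁻¹ (vecOf U)).re / d)) := by
    rw [hc]
    ring
  rw [hcN] at h3 h4
  refine ⟨by nlinarith, fun he => ?_⟩
  have h5 := h4 (by rw [he, mul_one])
  let W : Op d := (Real.sqrt c)⁻¹ • A
  have hW : Wᴴ * W = 1 := by
    have hsq : (Real.sqrt c)⁻¹ * (Real.sqrt c)⁻¹ = c⁻¹ := by
      rw [← mul_inv, Real.mul_self_sqrt hc0.le]
    simp only [W, Matrix.conjTranspose_smul, star_trivial, Matrix.smul_mul, Matrix.mul_smul,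
      smul_smul, h5, ← mul_assoc, hsq, inv_mul_cancel₀ hc0.ne', one_smul]
  have hAW : A = Real.sqrt c • W := by
    have : Real.sqrt c ≠ 0 := (Real.sqrt_pos.mpr hc0).ne'
    rw [smul_smul, mul_inv_cancel₀ this, one_smul]
  refine ⟨⟨W, Matrix.mem_unitaryGroup_iff'.mpr hW⟩, ?_⟩
  -- In the equality case `A†A = c I`, so the positive semidefinite matrix `h1` has trace zero and
  -- vanishes.
  have h6 : s • K = Matrix.vecMulVec (vecOf A) (star (vecOf A)) := by
    refine sub_eq_zero.mp (h1.trace_eq_zero_iff.mp ?_)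
    rw [Matrix.trace_sub, trace_vecMulVec_vecOf, h5, Matrix.trace_smul, ← trace_partialTrace, hb,
      ← Matrix.trace_smul, smul_smul, ← mul_div_assoc, ← hc, sub_self]
  have h7 : Matrix.vecMulVec (vecOf A) (star (vecOf A)) = (c * d) • choi (conjMap W) := by
    have hsq : Real.sqrt c * Real.sqrt c = c := Real.mul_self_sqrt hc0.le
    rw [hAW, vecOf_smul, star_smul, star_trivial, Matrix.smul_vecMulVec, Matrix.vecMulVec_smul,
      smul_smul, hsq, vecMulVec_vecOf_eq_smul_choi hd, smul_smul]
  rw [h7, hc, div_mul_cancel₀ _ hd'.ne', mul_smul] at h6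
  exact smul_right_injective _ hs0.ne' h6

/-! ### Bounding the weights of boundary decompositions and attaining the bound. -/

section ChannelDecomposition

variable {d : ℕ} {F : SuperOp d} {U : Op d}

theorem one_le_of_mem_boundaryWeights (hd : 0 < d) (hJ : (choi F).PosDef)
    (hU : IsContractionMax (choi F)⁻¹ U) {w : ℝ} (hw : w ∈ boundaryWeights (channels d) F) :
    0 < w ∧ 1 ≤ (1 - w) * ((sandwich (choi F)⁻¹ (vecOf U)).re / d) := by
  obtain ⟨m, p, x, hp, hsum, hx, hF, ⟨j, rfl⟩, hmax⟩ := hw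
  refine ⟨?_, ?_⟩
  · by_contra! hc
    have h1 : ∑ i, p i ≤ 0 :=
      Finset.sum_nonpos fun i _ => (hmax ⟨i, rfl⟩).trans hc
    linarith
  · obtain ⟨hG, v, hv, hGv⟩ := (mem_relBoundary_channels_iff hd _).mp (hx j)
    have hK : choi F - p j • choi (x j) = ∑ i ∈ Finset.univ.erase j, p i • choi (x i) := by
      rw [sub_eq_iff_eq_add, Finset.sum_erase_add _ _ (Finset.mem_univ j), hF, choi_sum]
      simp only [choi_smul]
    have hFmem : partialTrace (choi F) = (1 / (d : ℝ)) • (1 : Op d) := by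
      have hlin : partialTrace (choi F) = ∑ i, p i • partialTrace (choi (x i)) := by
        rw [hF, choi_sum]
        simp only [choi_smul]
        ext a b
        simp only [partialTrace, Matrix.sum_apply, Matrix.submatrix_apply, Matrix.smul_apply,
          Finset.smul_sum]
        rw [Finset.sum_comm]
      rw [hlin]
      simp only [((mem_channels_iff hd _).mp (hx _).1).2]
      rw [← Finset.sum_smul, hsum, one_smul]
    refine (hU.le_of_mulVec_eq hd hJ (K := choi F - p j • choi (x j)) ?_ hv ?_ ?_).1
    · rw [hK]
      exact Matrix.posSemidef_sum _ fun i _ =>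
        ((mem_channels_iff hd _).mp (hx i).1).1.smul (hp i).1
    · rw [Matrix.sub_mulVec, Matrix.smul_mulVec, hGv, smul_zero, sub_zero]
    · rw [partialTrace_sub, partialTrace_smul, hFmem, ((mem_channels_iff hd _).mp hG).2]
      module

theorem vecOf_ne_zero_of_mem_unitaryGroup (hd : 0 < d) (U : Matrix.unitaryGroup (Fin d) ℂ) :
    vecOf (U : Op d) ≠ 0 := by
  have : Nonempty (Fin d) := ⟨⟨0, hd⟩⟩
  intro h
  have h1 := Matrix.UnitaryGroup.star_mul_self U
  rw [vecOf_eq_zero_iff.mp h, mul_zero] at h1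
  exact zero_ne_one h1

theorem sandwich_inv_pos (hd : 0 < d) (hJ : (choi F).PosDef)
    (U : Matrix.unitaryGroup (Fin d) ℂ) : 0 < (sandwich (choi F)⁻¹ (vecOf (U : Op d))).re :=
  hJ.inv.re_dotProduct_pos (vecOf_ne_zero_of_mem_unitaryGroup hd U)

/-- The coefficient is the largest multiple of the unitary channel that can be subtracted.
Positivity is Cauchy–Schwarz for `choi F`, with equality at the kernel vector `(choi F)⁻¹ |U⟩⟩`. -/
theorem exists_mulVec_eq_zero_sub_smul_choi_conjMap (hd : 0 < d) (hJ : (choi F).PosDef)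
    (U : Matrix.unitaryGroup (Fin d) ℂ) :
    (choi F - ((sandwich (choi F)⁻¹ (vecOf (U : Op d))).re / d)⁻¹ •
        choi (conjMap (U : Op d))).PosSemidef ∧
      ∃ v, v ≠ 0 ∧ (choi F - ((sandwich (choi F)⁻¹ (vecOf (U : Op d))).re / d)⁻¹ •
        choi (conjMap (U : Op d))) *ᵥ v = 0 := by
  have hd' : (0 : ℝ) < d := by exact_mod_cast hd
  have hN := sandwich_inv_pos hd hJ U
  have hre := hJ.inv.1.sandwich_eq_ofReal (vecOf (U : Op d))
  set N := (sandwich (choi F)⁻¹ (vecOf (U : Op d))).re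
  set u := vecOf (U : Op d) with hu
  have hJv : choi F *ᵥ ((choi F)⁻¹ *ᵥ u) = u := by
    rw [Matrix.mulVec_mulVec, Matrix.mul_nonsing_inv _ ((Matrix.isUnit_iff_isUnit_det _).mp
      hJ.isUnit), Matrix.one_mulVec]
  have hs : star ((choi F)⁻¹ *ᵥ u) ⬝ᵥ u = (N : ℂ) := by
    rw [Matrix.star_mulVec, hJ.inv.1.eq, ← Matrix.dotProduct_mulVec]
    exact hre
  have hK : choi F - (N / d)⁻¹ • choi (conjMap (U : Op d)) =
      N⁻¹ • (N • choi F - Matrix.vecMulVec u (star u)) := by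
    rw [vecMulVec_vecOf_eq_smul_choi hd, smul_sub, smul_smul, smul_smul,
      inv_mul_cancel₀ hN.ne', one_smul]
    congr 2
    field_simp
  rw [hK]
  refine ⟨(hJ.posSemidef.smul_sub_vecMulVec hJv hs hN).smul (by positivity),
    (choi F)⁻¹ *ᵥ u, ?_, ?_⟩
  · intro h0
    rw [h0, Matrix.mulVec_zero] at hJv
    exact vecOf_ne_zero_of_mem_unitaryGroup hd U hJv.symm
  · rw [Matrix.smul_mulVec, Matrix.sub_mulVec, Matrix.smul_mulVec, hJv, Matrix.vecMulVec_mulVec]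
    have : star u ⬝ᵥ ((choi F)⁻¹ *ᵥ u) = (N : ℂ) := hre
    rw [this]
    ext i
    simp

theorem boundariness_eq_inv (hd : 0 < d) (hF : F ∈ channels d) (hJ : (choi F).PosDef)
    (U : Matrix.unitaryGroup (Fin d) ℂ) (hU : IsContractionMax (choi F)⁻¹ (U : Op d)) :
    boundariness (channels d) F =
      ((sandwich (choi F)⁻¹ (vecOf (U : Op d))).re / d)⁻¹ := by
  have hd' : (0 : ℝ) < d := by exact_mod_cast hd
  have hN := sandwich_inv_pos hd hJ U
  have hupper := fun w => one_le_of_mem_boundaryWeights (w := w) hd hJ hU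
  obtain ⟨hK, v, hv, hKv⟩ := exists_mulVec_eq_zero_sub_smul_choi_conjMap hd hJ U
  obtain ⟨b, hb⟩ : ∃ b, b = ((sandwich (choi F)⁻¹ (vecOf (U : Op d))).re / d)⁻¹ := ⟨_, rfl⟩
  have hb0 : 0 < b := by rw [hb]; positivity
  rw [← inv_inv ((sandwich (choi F)⁻¹ (vecOf (U : Op d))).re / d), ← hb] at hupper
  have hupper' : ∀ w ∈ boundaryWeights (channels d) F, 0 < w ∧ w ≤ 1 - b := by
    intro w hw
    obtain ⟨h1, h2⟩ := hupper w hw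
    rw [← div_eq_mul_inv, one_le_div hb0] at h2
    exact ⟨h1, by linarith⟩
  rw [← hb] at hK hKv ⊢
  have hUmem := conjMap_mem_channels U
  have htr : (choi F - b • choi (conjMap (U : Op d))).trace = ((1 - b : ℝ) : ℂ) := by
    rw [Matrix.trace_sub, Matrix.trace_smul, trace_choi_of_mem hd hF, trace_choi_of_mem hd hUmem]
    simp
  have hb1 : b ≤ 1 := by
    have := hK.trace_nonneg
    rw [htr] at this
    have : 0 ≤ 1 - b := by exact_mod_cast this
    linarith
  rcases hb1.eq_or_lt with rfl | hb1
  -- With `b = 1` every weight would be both positive and at most 0, so there are none; `sSup ∅ = 0`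
  -- then gives the value 1.
  · have : boundaryWeights (channels d) F = ∅ := by
      refine Set.eq_empty_of_forall_notMem fun w hw => ?_
      have := hupper' w hw
      linarith
    rw [boundariness, this, Real.sSup_empty, sub_zero]
  · have h1b : 0 < 1 - b := by linarith
    let G : SuperOp d := (1 - b)⁻¹ • (F - b • conjMap (U : Op d))
    have hchoiG : choi G = (1 - b)⁻¹ • (choi F - b • choi (conjMap (U : Op d))) := by
      rw [choi_smul, choi_sub, choi_smul]
    have hG : G ∈ relBoundary (channels d) := by
      rw [mem_relBoundary_channels_iff hd, mem_channels_iff hd, hchoiG]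
      refine ⟨⟨hK.smul (by positivity), ?_⟩, v, hv, ?_⟩
      · rw [partialTrace_smul, partialTrace_sub, partialTrace_smul,
          ((mem_channels_iff hd _).mp hF).2, ((mem_channels_iff hd _).mp hUmem).2]
        match_scalars
        field_simp
      · rw [Matrix.smul_mulVec, hKv, smul_zero]
    -- A `1 × 1` matrix with nonzero trace `1 - b` has no kernel. Nontriviality makes the rank-one
    -- Choi operator of a unitary channel singular, so that channel is a boundary point.
    have hnt : Nontrivial (Fin d × Fin d) := by
      by_contra hs
      rw [not_nontrivial_iff_subsingleton] at hs
      let i : Fin d × Fin d := (⟨0, hd⟩, ⟨0, hd⟩)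
      have hvi : v i ≠ 0 := by
        intro h0
        apply hv
        ext k
        rw [Subsingleton.elim k i, h0, Pi.zero_apply]
      let _ : Unique (Fin d × Fin d) := ⟨⟨i⟩, fun k => Subsingleton.elim k i⟩
      have h1 := congrFun hKv i
      rw [Matrix.trace, Fintype.sum_unique] at htr
      simp only [Matrix.mulVec, dotProduct, Fintype.sum_unique, Pi.zero_apply] at h1
      rw [Matrix.diag_apply] at htr
      rw [show (i : Fin d × Fin d) = default from rfl, htr] at h1
      rcases mul_eq_zero.mp h1 with h | h
      · have : 1 - b = 0 := by exact_mod_cast h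
        linarith
      · exact hvi h
    have hUb : conjMap (U : Op d) ∈ relBoundary (channels d) := by
      rw [mem_relBoundary_channels_iff hd, Matrix.exists_mulVec_eq_zero_iff]
      refine ⟨hUmem, ?_⟩
      rw [choi_conjMap, ← Matrix.smul_vecMulVec, Matrix.det_vecMulVec]
    have hmem : max (1 - b) b ∈ boundaryWeights (channels d) F := by
      refine ⟨2, ![1 - b, b], ![G, conjMap (U : Op d)], ?_, ?_, ?_, ?_, ?_⟩
      · simp only [Fin.forall_fin_two, Matrix.cons_val_zero, Matrix.cons_val_one]
        exact ⟨⟨h1b.le, by linarith⟩, hb0.le, hb1.le⟩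
      · simp [Fin.sum_univ_two]
      · simp only [Fin.forall_fin_two, Matrix.cons_val_zero, Matrix.cons_val_one]
        exact ⟨hG, hUb⟩
      · simp only [Fin.sum_univ_two, Matrix.cons_val_zero, Matrix.cons_val_one, G]
        rw [smul_smul, mul_inv_cancel₀ h1b.ne', one_smul, sub_add_cancel]
      · rw [Matrix.range_cons, Matrix.range_cons, Matrix.range_empty, Set.union_empty,
          Set.singleton_union]
        exact isGreatest_pair
    -- The upper bound applies to this very decomposition, so `b ≤ 1 - b` needs no separate proof.
    have hmax : max (1 - b) b = 1 - b :=
      le_antisymm (hupper' _ hmem).2 (le_max_left _ _)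
    rw [hmax] at hmem
    have : IsGreatest (boundaryWeights (channels d) F) (1 - b) :=
      ⟨hmem, fun w hw => (hupper' w hw).2⟩
    rw [boundariness, this.csSup_eq]
    ring

end ChannelDecomposition

/-! ### Spectrum of rank-one matrices, and the main theorem. -/

/-- Pairing an eigenvector equation with `y` shows that the only possible eigenvalues are 0 and `y
⬝ᵥ x`; the sign of `l` puts 0 below it. -/
theorem isMaxEigenvalue_vecMulVec {ι : Type*} [Fintype ι] [DecidableEq ι] {x y : ι → ℂ} {l : ℝ}
    (hx : x ≠ 0) (hl : y ⬝ᵥ x = l) (hl0 : 0 ≤ l) : IsMaxEigenvalue (Matrix.vecMulVec x y) l := by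
  refine ⟨?_, fun z hz => ?_⟩
  · refine Module.End.hasEigenvalue_of_hasEigenvector (x := x)
      (Module.End.hasEigenvector_iff.mpr ⟨Module.End.mem_eigenspace_iff.mpr ?_, hx⟩)
    rw [Matrix.toLin'_apply, Matrix.vecMulVec_mulVec, hl]
    ext i
    simp [mul_comm]
  · obtain ⟨v, hv⟩ := hz.exists_hasEigenvector
    have h1 := hv.apply_eq_smul
    rw [Matrix.toLin'_apply, Matrix.vecMulVec_mulVec] at h1
    have h2 : (y ⬝ᵥ v) * l = z * (y ⬝ᵥ v) := by
      have := congrArg (y ⬝ᵥ ·) h1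
      simpa [dotProduct_smul, hl, mul_comm] using this
    by_cases h3 : y ⬝ᵥ v = 0
    · rw [h3] at h1
      have h4 : z = 0 := by
        have : z • v = 0 := by rw [← h1]; simp
        exact (smul_eq_zero.mp this).resolve_right hv.2
      simp [h4, hl0]
    · have h4 : z = l := by
        apply mul_right_cancel₀ h3
        rw [← h2, mul_comm]
      simp [h4]

theorem mainTheorem1 (d : ℕ) (hd : 0 < d) (F : SuperOp d)
    (hF : F ∈ intrinsicInterior ℝ (channels d)) :
    IsUnit (choi F) ∧
    (∃ lam : Matrix.unitaryGroup (Fin d) ℂ → ℝ,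
      (∀ U : Matrix.unitaryGroup (Fin d) ℂ,
        IsMaxEigenvalue ((choi F)⁻¹ * choi (conjMap (U : Op d))) (lam U)) ∧
      ∃ M : ℝ, IsGreatest (Set.range lam) M ∧ 0 < M ∧
        boundariness (channels d) F = M⁻¹) ∧
    (∃ q : Matrix.unitaryGroup (Fin d) ℂ → ℝ,
      (∀ U : Matrix.unitaryGroup (Fin d) ℂ,
        sandwich (choi F)⁻¹ (vecOf (U : Op d)) = (q U : ℂ)) ∧
      ∃ N : ℝ, IsGreatest (Set.range q) N ∧ 0 < N ∧
        boundariness (channels d) F = (d : ℝ) / N) ∧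
    (∀ E ∈ channels d, ∀ G ∈ relBoundary (channels d),
      F = boundariness (channels d) F • E + (1 - boundariness (channels d) F) • G →
      ∃ U : Matrix.unitaryGroup (Fin d) ℂ, E = conjMap (U : Op d)) := by
  have hJ := posDef_choi_of_mem_intrinsicInterior hd hF
  have hFmem : F ∈ channels d := intrinsicInterior_subset hF
  have hd' : (0 : ℝ) < d := by exact_mod_cast hd
  obtain ⟨U₀, hU₀⟩ := exists_unitary_forall_contraction_le hJ.inv
  have hb := boundariness_eq_inv hd hFmem hJ U₀ hU₀
  have hN := sandwich_inv_pos hd hJ U₀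
  have hle : ∀ U : Matrix.unitaryGroup (Fin d) ℂ, (sandwich (choi F)⁻¹ (vecOf (U : Op d))).re ≤
      (sandwich (choi F)⁻¹ (vecOf (U₀ : Op d))).re := by
    intro U
    refine (hU₀ U ?_).1
    have : (U : Op d)ᴴ * U = 1 := Matrix.UnitaryGroup.star_mul_self U
    rw [this, sub_self]
    exact .zero
  refine ⟨hJ.isUnit, ⟨fun U => (sandwich (choi F)⁻¹ (vecOf (U : Op d))).re / d, fun U => ?_,
    _, ⟨⟨U₀, rfl⟩, ?_⟩, div_pos hN hd', hb⟩,
    ⟨fun U => (sandwich (choi F)⁻¹ (vecOf (U : Op d))).re, fun U => hJ.inv.1.sandwich_eq_ofReal _,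
    _, ⟨⟨U₀, rfl⟩, ?_⟩, hN, hb.trans (inv_div _ _)⟩, ?_⟩
  · have h1 : (choi F)⁻¹ * choi (conjMap (U : Op d)) =
        Matrix.vecMulVec ((choi F)⁻¹ *ᵥ vecOf (U : Op d))
          ((1 / (d : ℝ)) • star (vecOf (U : Op d))) := by
      rw [choi_conjMap, Matrix.mul_smul, Matrix.mul_vecMulVec, Matrix.vecMulVec_smul]
    rw [h1]
    refine isMaxEigenvalue_vecMulVec ?_ ?_ (div_pos (sandwich_inv_pos hd hJ U) hd').le
    · intro h0
      have := sandwich_inv_pos hd hJ U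
      simp [sandwich, h0] at this
    · have := hJ.inv.1.sandwich_eq_ofReal (vecOf (U : Op d))
      rw [smul_dotProduct, ← sandwich, this, Complex.real_smul]
      push_cast
      simp
      ring
  · rintro _ ⟨U, rfl⟩
    exact div_le_div_of_nonneg_right (hle U) hd'.le
  · rintro _ ⟨U, rfl⟩
    exact hle U
  · intro E hE G hG hdec
    obtain ⟨b, hbb⟩ : ∃ b, b = boundariness (channels d) F := ⟨_, rfl⟩
    rw [← hbb] at hdec hb
    have hb0 : 0 < b := by
      rw [hb]
      positivity
    obtain ⟨-, v, hv, hGv⟩ := (mem_relBoundary_channels_iff hd _).mp hG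
    obtain ⟨hE1, hE2⟩ := (mem_channels_iff hd _).mp hE
    -- On a kernel vector of `choi G` only the `E` term survives, so the equality case of the core
    -- estimate applies with `K = b • choi E`.
    have hKv : (b • choi E) *ᵥ v = choi F *ᵥ v := by
      conv_rhs => rw [hdec]
      rw [choi_add, choi_smul, choi_smul, Matrix.add_mulVec, Matrix.smul_mulVec (1 - b), hGv,
        smul_zero, add_zero]
    obtain ⟨W, hW⟩ := (IsContractionMax.le_of_mulVec_eq hd hJ hU₀ (hE1.smul hb0.le) hv hKv
      (b := b) (by rw [partialTrace_smul, hE2, smul_smul, mul_one_div])).2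
      (by rw [hb, inv_mul_cancel₀ (div_pos hN hd').ne'])
    exact ⟨W, choi_injective (smul_right_injective _ hb0.ne' hW)⟩
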